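/- Let $(g_k)_{k\ge 1}$ and $(g'_k)_{k\ge 1}$ be two independent sequences of i.i.d. $\mathcal N(0,1)$ random variables on a common probability space $(\Omega,\mathcal A,\mathbb P)$, let $(a_k)_{k\ge 1}$ be real numbers and let $(j_k)_{k\ge 1}$ be a strictly increasing sequence of integers. For real $x\ge 1$ put $$A(x)=\sum_{1\le k\le x}a_k^2,\qquad X_x(t)=\sum_{1\le k\le x}a_k\big(g_k\cos 2\pi j_kt+g'_k\sin 2\pi j_kt\big),\quad 0\le t\le 1 .$$ There is an absolute constant $C>0$ such that the following holds. Let $0<\eta<1$, and assume that $A(x)\sim\log\log x$ as $x\to\infty$ and that $B=\sum_{k\ge 1}a_k^4<\infty$. Then for all $x$ large enough (how large may depend on $\eta$, $(a_k)$ and $(j_k)$), $$\mathbb P\Big\{\sup_{0\le t\le 1}X_x(t)\le\sqrt{2\eta\,(\log\log x)(\log\log\log x)}\Big\}\ \le\ \exp\Big(-\frac{C\,(\log\log x)^{1-\eta}}{\sqrt{8\eta\,(B+1)\,\log\log\log x}}\Big).$$ -/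

import Mathlib

open Filter MeasureTheory ProbabilityTheory Asymptotics

noncomputable section

namespace GaussTrig

/-- `(g_k)_{k ≥ 1}` and `(g'_k)_{k ≥ 1}` are two independent sequences of i.i.d. standard normal
random variables, that is, all the variables `g_k`, `g'_k` (`k ≥ 1`) are mutually independent and
standard normal. The entries with index `0` are not used. -/
structure IsStdNormalPair {Ω : Type*} [MeasurableSpace Ω] (P : Measure Ω) (g g' : ℕ → Ω → ℝ) :
    Prop where
  hasLaw_left : ∀ k, 1 ≤ k → HasLaw (g k) (gaussianReal 0 1) P
  hasLaw_right : ∀ k, 1 ≤ k → HasLaw (g' k) (gaussianReal 0 1) P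
  indep : iIndepFun (Sum.elim (fun k : ℕ => g (k + 1)) (fun k : ℕ => g' (k + 1))) P

/-- `A(x) = ∑_{1 ≤ k ≤ x} a_k²`. -/
def A (a : ℕ → ℝ) (x : ℝ) : ℝ := ∑ k ∈ Finset.Icc 1 ⌊x⌋₊, a k ^ 2

/-- `X_x(t) = ∑_{1 ≤ k ≤ x} a_k (g_k cos (2π j_k t) + g'_k sin (2π j_k t))`. -/
def X {Ω : Type*} (a : ℕ → ℝ) (j : ℕ → ℤ) (g g' : ℕ → Ω → ℝ) (x t : ℝ) (ω : Ω) : ℝ :=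
  ∑ k ∈ Finset.Icc 1 ⌊x⌋₊,
    a k * (g k ω * Real.cos (2 * Real.pi * j k * t) + g' k ω * Real.sin (2 * Real.pi * j k * t))

/-- The supremum of `X_x` over `[0, 1]`; it is finite by `bddAbove_X`. -/
def supX {Ω : Type*} (a : ℕ → ℝ) (j : ℕ → ℤ) (g g' : ℕ → Ω → ℝ) (x : ℝ) (ω : Ω) : ℝ :=
  ⨆ t : Set.Icc (0 : ℝ) 1, X a j g g' x t ω

theorem bddAbove_X {Ω : Type*} (a : ℕ → ℝ) (j : ℕ → ℤ) (g g' : ℕ → Ω → ℝ) (x : ℝ) (ω : Ω) :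
    BddAbove (Set.range fun t : Set.Icc (0 : ℝ) 1 => X a j g g' x t ω) := by
  refine (isCompact_range ?_).bddAbove
  unfold X
  fun_prop

end GaussTrig

end

/-! ### Gaussian concentration for functions with bounded gradient. -/

section GaussianConcentration

variable {E : Type*} [NormedAddCommGroup E] [InnerProductSpace ℝ E] [FiniteDimensional ℝ E]
  [MeasurableSpace E] [BorelSpace E]

/-! Write L = log log x. The supremum dominates the maximum over a grid of points i/n, where n is so
large that the frequencies in play are distinct modulo n. The characters are then orthonormal on the
grid, whatever the integers j_k are.

Suppose first that every a_k² is at most w. If the process stays below M on the grid, then the grid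
average of a smooth hinge of (value − M)/σ, multiplied by σ, vanishes. The mean of this average is
at least of order σq, where q is a lower bound for a one-point Gaussian tail slightly beyond M. By
Bessel's inequality its gradient has norm at most √w. Gaussian concentration then gives the bound
exp(-(σq)²/(180w)); this is `stdGaussian_real_forall_inner_le`.

The terms with a_k² > w have total variance at most B/w, because a_k⁴ is summable. They form an
independent part whose mean square over the grid is at most L outside a chi-square tail event
(`real_lt_sum_mul_sq_le`). By Chebyshev's inequality this part is then at most √(2L) in absolute
value on at least half of the grid, and conditionally on it the first argument applies to those
points (`real_forall_sum_le`).

With w = L^(-(1+η)/2) the variance B/w is o(L). With σ = √L and M the level of the theorem, q is at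
least L^(-(η+κ)) for a small κ, and (σq)²/w is at least L^(5(1-η)/4), which beats L^(1-η). The
resulting bound exp(-L^(1-η)) is stronger than the one required, whose denominator tends to
infinity. -/

theorem map_inner_stdGaussian (v : E) :
    (stdGaussian E).map (fun y => inner ℝ v y) = gaussianReal 0 (‖v‖₊ ^ 2) := by
  have h := IsGaussian.map_eq_gaussianReal (μ := stdGaussian E) (innerSL ℝ v)
  rw [variance_dual_stdGaussian, integral_strongDual_stdGaussian] at h
  have h2 : (‖innerSL ℝ v‖ ^ 2).toNNReal = ‖v‖₊ ^ 2 := by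
    rw [innerSL_apply_norm]
    ext
    simp
  rw [h2] at h
  exact h

theorem lintegral_exp_inner_stdGaussian (v : E) :
    ∫⁻ y, ENNReal.ofReal (Real.exp (inner ℝ v y)) ∂stdGaussian E
      = ENNReal.ofReal (Real.exp (‖v‖ ^ 2 / 2)) := by
  have h := mgf_gaussianReal (map_inner_stdGaussian v) 1
  simp only [mgf, one_mul, zero_add, NNReal.coe_pow, coe_nnnorm, one_pow, mul_one] at h
  rw [← h, ofReal_integral_eq_lintegral_ofReal]
  · have := integrable_exp_mul_gaussianReal (μ := 0) (v := ‖v‖₊ ^ 2) 1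
    rw [← map_inner_stdGaussian v, integrable_map_measure (by fun_prop) (by fun_prop)] at this
    simpa [Function.comp_def] using this
  · exact ae_of_all _ fun _ => (Real.exp_pos _).le

/-- The exponential-moment form of Gaussian concentration, by the rotation argument of Maurey and
Pisier. -/
theorem lintegral_exp_sub_stdGaussian_le {Φ : E → ℝ} {Φ' : E → E} (hΦ' : Continuous Φ')
    (hd : ∀ x, HasGradientAt Φ (Φ' x) x) {K : ℝ} (hK : ∀ x, ‖Φ' x‖ ≤ K) (s : ℝ) :
    ∫⁻ p, ENNReal.ofReal (Real.exp (s * (Φ p.2 - Φ p.1))) ∂((stdGaussian E).prod (stdGaussian E))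
      ≤ ENNReal.ofReal (Real.exp ((s * (Real.pi / 2) * K) ^ 2 / 2)) := by
  set μ := stdGaussian E
  set c : ℝ := s * (Real.pi / 2) with hc
  have hpi := Real.pi_pos
  let I : Set ℝ := Set.Icc 0 (Real.pi / 2)
  -- The path cos θ • p.1 + sin θ • p.2 joins p.1 to p.2 and has velocity -sin θ • p.1 + cos θ •
  -- p.2. Jensen's inequality is applied to the uniform average over θ in [0, π/2], whence the
  -- factor π/2 in c.
  let G : ℝ → E × E → ℝ := fun θ p =>
    Real.exp (c * inner ℝ (Φ' (Real.cos θ • p.1 + Real.sin θ • p.2))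
      (-Real.sin θ • p.1 + Real.cos θ • p.2))
  have hG : Continuous (Function.uncurry G) := by
    unfold G Function.uncurry
    fun_prop
  have hvol : volume I = ENNReal.ofReal (Real.pi / 2) := by simp [I]
  have hvol0 : volume I ≠ 0 := by rw [hvol]; simp; positivity
  have hvolt : volume I ≠ ⊤ := by rw [hvol]; simp
  -- pointwise Jensen
  have hpt : ∀ p : E × E, ENNReal.ofReal (Real.exp (s * (Φ p.2 - Φ p.1))) ≤
      ENNReal.ofReal (Real.pi / 2)⁻¹ * ∫⁻ θ in I, ENNReal.ofReal (G θ p) := by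
    intro p
    let h : ℝ → ℝ := fun θ => inner ℝ (Φ' (Real.cos θ • p.1 + Real.sin θ • p.2))
      (-Real.sin θ • p.1 + Real.cos θ • p.2)
    have hh : Continuous h := by unfold h; fun_prop
    have hder : ∀ θ : ℝ, HasDerivAt (fun θ => Φ (Real.cos θ • p.1 + Real.sin θ • p.2)) (h θ) θ := by
      intro θ
      have h1 : HasDerivAt (fun θ : ℝ => Real.cos θ • p.1 + Real.sin θ • p.2)
          (-Real.sin θ • p.1 + Real.cos θ • p.2) θ :=
        ((Real.hasDerivAt_cos θ).smul_const _).add ((Real.hasDerivAt_sin θ).smul_const _)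
      have h2 := (hd (Real.cos θ • p.1 + Real.sin θ • p.2)).hasFDerivAt.comp_hasDerivAt θ h1
      simpa [h, Function.comp_def] using h2
    have hint : ∫ θ in (0 : ℝ)..(Real.pi / 2), h θ = Φ p.2 - Φ p.1 := by
      rw [intervalIntegral.integral_eq_sub_of_hasDerivAt (fun θ _ => hder θ)
        (hh.intervalIntegrable _ _)]
      simp
    have hint' : ∫ θ in I, h θ = Φ p.2 - Φ p.1 := by
      rw [← hint, intervalIntegral.integral_of_le (by positivity), integral_Icc_eq_integral_Ioc]
    have hJ := ConvexOn.map_set_average_le (μ := volume) (t := I) (f := fun θ => c * h θ)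
      convexOn_exp Real.continuous_exp.continuousOn isClosed_univ hvol0 hvolt
      (ae_of_all _ fun _ => Set.mem_univ _)
      ((by fun_prop : Continuous fun θ => c * h θ).continuousOn.integrableOn_compact isCompact_Icc)
      ((by fun_prop : Continuous (Real.exp ∘ fun θ => c * h θ)).continuousOn.integrableOn_compact
        isCompact_Icc)
    have hr : volume.real I = Real.pi / 2 := by
      simp [I, Measure.real, show 0 ≤ Real.pi / 2 by positivity]
    rw [setAverage_eq, setAverage_eq, integral_const_mul, hint', hr, smul_eq_mul, smul_eq_mul] at hJ
    have e1 : (Real.pi / 2)⁻¹ * (c * (Φ p.2 - Φ p.1)) = s * (Φ p.2 - Φ p.1) := by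
      rw [hc]; field_simp
    rw [e1] at hJ
    refine (ENNReal.ofReal_le_ofReal hJ).trans ?_
    rw [ENNReal.ofReal_mul (by positivity), ofReal_integral_eq_lintegral_ofReal]
    · exact ((by fun_prop : Continuous (fun θ => Real.exp (c * h θ))).continuousOn.integrableOn_compact
        isCompact_Icc)
    · exact ae_of_all _ fun _ => (Real.exp_pos _).le
  refine (lintegral_mono hpt).trans ?_
  rw [lintegral_const_mul _ (by
    apply Measurable.lintegral_prod_right' (f := fun q : (E × E) × ℝ => ENNReal.ofReal (G q.2 q.1))
    have : Measurable fun q : (E × E) × ℝ => G q.2 q.1 :=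
      (hG.comp (continuous_snd.prodMk continuous_fst)).measurable
    fun_prop)]
  rw [lintegral_lintegral_swap (by
    have : Measurable (Function.uncurry fun (p : E × E) (θ : ℝ) => G θ p) :=
      (hG.comp (continuous_snd.prodMk continuous_fst)).measurable
    exact (ENNReal.measurable_ofReal.comp this).aemeasurable)]
  have hθ : ∀ θ, ∫⁻ p, ENNReal.ofReal (G θ p) ∂(μ.prod μ)
      ≤ ENNReal.ofReal (Real.exp ((c * K) ^ 2 / 2)) := by
    intro θ
    have hcont : Continuous fun p : E × E => Real.exp (c * inner ℝ (Φ' p.1) p.2) := by fun_prop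
    -- For each θ, position and velocity are again independent standard Gaussians, so the velocity
    -- can be integrated out with the position fixed.
    have hrot := IsGaussian.map_rotation_eq_self_of_forall_strongDual_eq_zero (μ := μ)
      (fun L => integral_strongDual_stdGaussian L) θ
    have h1 : ∫⁻ p, ENNReal.ofReal (G θ p) ∂(μ.prod μ)
        = ∫⁻ p, ENNReal.ofReal (Real.exp (c * inner ℝ (Φ' p.1) p.2)) ∂(μ.prod μ) := by
      conv_rhs => rw [← hrot]
      rw [lintegral_map (by fun_prop) (by fun_prop)]
      rfl
    rw [h1, lintegral_prod _ (by fun_prop)]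
    have h2 : ∀ x : E, ∫⁻ y, ENNReal.ofReal (Real.exp (c * inner ℝ (Φ' x) y)) ∂μ
        ≤ ENNReal.ofReal (Real.exp ((c * K) ^ 2 / 2)) := by
      intro x
      have := lintegral_exp_inner_stdGaussian (c • Φ' x)
      simp only [real_inner_smul_left] at this
      rw [this, norm_smul, mul_pow, mul_pow, Real.norm_eq_abs, sq_abs]
      gcongr
      exact hK x
    calc _ ≤ ∫⁻ _ : E, ENNReal.ofReal (Real.exp ((c * K) ^ 2 / 2)) ∂μ := lintegral_mono h2
      _ = _ := by simp [μ]
  calc _ ≤ ENNReal.ofReal (Real.pi / 2)⁻¹ *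
        ∫⁻ _ in I, ENNReal.ofReal (Real.exp ((c * K) ^ 2 / 2)) := by
        gcongr; exact hθ _
    _ = ENNReal.ofReal (Real.exp ((c * K) ^ 2 / 2)) := by
        rw [setLIntegral_const, hvol, mul_comm, mul_assoc,
          ← ENNReal.ofReal_mul (by positivity), mul_inv_cancel₀ (by positivity)]
        simp

/-- Gaussian lower deviation for a function with bounded gradient. -/
theorem stdGaussian_real_le_zero_le {Φ : E → ℝ} {Φ' : E → E} (hΦ' : Continuous Φ')
    (hd : ∀ x, HasGradientAt Φ (Φ' x) x) (hint : Integrable Φ (stdGaussian E))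
    {K : ℝ} (hK0 : 0 < K) (hK : ∀ x, ‖Φ' x‖ ≤ K) {m : ℝ} (hm0 : 0 ≤ m)
    (hm : m ≤ ∫ x, Φ x ∂stdGaussian E) :
    (stdGaussian E).real {x | Φ x ≤ 0} ≤ Real.exp (-(m ^ 2 / (2 * (Real.pi / 2) ^ 2 * K ^ 2))) := by
  set μ := stdGaussian E
  have hpi := Real.pi_pos
  -- The minimizer of (s (π/2) K)² / 2 - s m.
  set s : ℝ := m / ((Real.pi / 2) ^ 2 * K ^ 2) with hs
  have hs0 : 0 ≤ s := by positivity
  have hc : Continuous Φ := continuous_iff_continuousAt.2 fun x => (hd x).hasFDerivAt.continuousAt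
  have hmain := lintegral_exp_sub_stdGaussian_le hΦ' hd hK s
  have hS : MeasurableSet {x | Φ x ≤ 0} := measurableSet_le hc.measurable measurable_const
  -- Jensen through the tangent line of exp at s * m, which needs no integrability of exp (s * Φ).
  have hJ : ENNReal.ofReal (Real.exp (s * m)) ≤ ∫⁻ y, ENNReal.ofReal (Real.exp (s * Φ y)) ∂μ := by
    have hi0 : Integrable (fun y => s * (Φ y - m)) μ :=
      (hint.sub (integrable_const m)).const_mul s
    have hi : Integrable (fun y => Real.exp (s * m) * (1 + s * (Φ y - m))) μ :=
      ((integrable_const 1).add hi0).const_mul _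
    have e : ∫ y, Real.exp (s * m) * (1 + s * (Φ y - m)) ∂μ
        = Real.exp (s * m) * (1 + s * ((∫ y, Φ y ∂μ) - m)) := by
      rw [integral_const_mul, integral_add (integrable_const 1) hi0, integral_const_mul,
        integral_sub hint (integrable_const m)]
      simp [μ]
    calc ENNReal.ofReal (Real.exp (s * m))
        ≤ ENNReal.ofReal (∫ y, Real.exp (s * m) * (1 + s * (Φ y - m)) ∂μ) := by
          apply ENNReal.ofReal_le_ofReal
          rw [e]
          have : 0 ≤ s * ((∫ y, Φ y ∂μ) - m) := mul_nonneg hs0 (by linarith)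
          nlinarith [Real.exp_pos (s * m)]
      _ ≤ ∫⁻ y, ENNReal.ofReal (Real.exp (s * m) * (1 + s * (Φ y - m))) ∂μ :=
          ENNReal.ofReal_le_of_le_toReal (by
            rw [integral_eq_lintegral_pos_part_sub_lintegral_neg_part hi]
            exact sub_le_self _ ENNReal.toReal_nonneg)
      _ ≤ _ := by
          apply lintegral_mono
          intro y
          apply ENNReal.ofReal_le_ofReal
          have h1 := Real.add_one_le_exp (s * (Φ y - m))
          calc Real.exp (s * m) * (1 + s * (Φ y - m))
              ≤ Real.exp (s * m) * Real.exp (s * (Φ y - m)) := by gcongr; linarith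
            _ = Real.exp (s * Φ y) := by rw [← Real.exp_add]; ring_nf
  have hlow : μ {x | Φ x ≤ 0} * ENNReal.ofReal (Real.exp (s * m))
      ≤ ∫⁻ p, ENNReal.ofReal (Real.exp (s * (Φ p.2 - Φ p.1))) ∂(μ.prod μ) := by
    rw [lintegral_prod _ (by fun_prop)]
    calc μ {x | Φ x ≤ 0} * ENNReal.ofReal (Real.exp (s * m))
        = ∫⁻ _ in {x | Φ x ≤ 0}, ENNReal.ofReal (Real.exp (s * m)) ∂μ := by
          rw [setLIntegral_const, mul_comm]
      _ ≤ ∫⁻ x in {x | Φ x ≤ 0}, ∫⁻ y, ENNReal.ofReal (Real.exp (s * (Φ y - Φ x))) ∂μ ∂μ := by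
          apply setLIntegral_mono' hS
          intro x hx
          refine hJ.trans (lintegral_mono fun y => ENNReal.ofReal_le_ofReal ?_)
          rw [Real.exp_le_exp]
          apply mul_le_mul_of_nonneg_left _ hs0
          have : Φ x ≤ 0 := hx
          linarith
      _ ≤ _ := setLIntegral_le_lintegral _ _
  have h3 := hlow.trans hmain
  have h4 : μ.real {x | Φ x ≤ 0} * Real.exp (s * m)
      ≤ Real.exp ((s * (Real.pi / 2) * K) ^ 2 / 2) := by
    have := ENNReal.toReal_mono ENNReal.ofReal_ne_top h3
    rwa [ENNReal.toReal_mul, ENNReal.toReal_ofReal (Real.exp_pos _).le,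
      ENNReal.toReal_ofReal (Real.exp_pos _).le] at this
  rw [← le_div_iff₀ (Real.exp_pos _), ← Real.exp_sub] at h4
  refine h4.trans (le_of_eq ?_)
  congr 1
  rw [hs]
  field_simp
  ring

end GaussianConcentration

/-! ### A smooth hinge function. -/

section Hinge

/-- A `C¹` version of the positive part, vanishing exactly on `(-∞, 0]`, with slope in `[0, 1]`. -/
noncomputable def smoothHinge (z : ℝ) : ℝ := ∫ u in (0 : ℝ)..z, max 0 (min u 1)

theorem hasDerivAt_smoothHinge (z : ℝ) : HasDerivAt smoothHinge (max 0 (min z 1)) z := by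
  have h : Continuous fun u : ℝ => max 0 (min u 1) := by fun_prop
  exact intervalIntegral.integral_hasDerivAt_right (h.intervalIntegrable _ _)
    (h.stronglyMeasurableAtFilter _ _) h.continuousAt

theorem continuous_smoothHinge : Continuous smoothHinge :=
  continuous_iff_continuousAt.2 fun z => (hasDerivAt_smoothHinge z).continuousAt

theorem smoothHinge_of_nonpos {z : ℝ} (hz : z ≤ 0) : smoothHinge z = 0 := by
  unfold smoothHinge
  rw [intervalIntegral.integral_symm, intervalIntegral.integral_of_le hz,
    setIntegral_congr_fun measurableSet_Ioc (g := fun _ => (0 : ℝ))]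
  · simp
  · intro u hu
    exact max_eq_left ((min_le_left _ _).trans hu.2)

theorem smoothHinge_nonneg (z : ℝ) : 0 ≤ smoothHinge z := by
  rcases le_total z 0 with h | h
  · exact (smoothHinge_of_nonpos h).ge
  · exact intervalIntegral.integral_nonneg h fun _ _ => le_max_left _ _

theorem monotone_smoothHinge : Monotone smoothHinge :=
  monotone_of_deriv_nonneg (fun z => (hasDerivAt_smoothHinge z).differentiableAt) fun z => by
    rw [(hasDerivAt_smoothHinge z).deriv]; exact le_max_left _ _

theorem one_le_smoothHinge {z : ℝ} (hz : 2 ≤ z) : 1 ≤ smoothHinge z := by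
  refine le_trans ?_ (monotone_smoothHinge hz)
  have h : Continuous fun u : ℝ => max 0 (min u 1) := by fun_prop
  have e : smoothHinge 2 = smoothHinge 1 + ∫ u in (1 : ℝ)..2, max 0 (min u 1) :=
    (intervalIntegral.integral_add_adjacent_intervals (h.intervalIntegrable _ _)
      (h.intervalIntegrable _ _)).symm
  have e2 : ∫ u in (1 : ℝ)..2, max 0 (min u 1) = ∫ _ in (1 : ℝ)..2, (1 : ℝ) := by
    apply intervalIntegral.integral_congr
    intro u hu
    rw [Set.uIcc_of_le (by norm_num)] at hu
    simp [hu.1]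
  rw [e, e2]
  have := smoothHinge_nonneg 1
  norm_num
  linarith

end Hinge

/-! ### A lower bound for the Gaussian tail. -/

section GaussianTail

/-- Only the interval [y, y + √v] is kept; the density there is smallest at the right end, and √(2π)
≤ 3. -/
theorem exp_le_gaussianReal_real_Ici {v : NNReal} (hv : v ≠ 0) {y : ℝ} (hy : 0 ≤ y) :
    Real.exp (-((y + √v) ^ 2 / (2 * v))) / 3 ≤ (gaussianReal 0 v).real (Set.Ici y) := by
  have hv0 : (0 : ℝ) < v := by positivity
  have hs : 0 < √(v : ℝ) := Real.sqrt_pos.2 hv0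
  have hss : √(v : ℝ) ^ 2 = v := Real.sq_sqrt hv0.le
  calc Real.exp (-((y + √v) ^ 2 / (2 * v))) / 3
      ≤ √v * gaussianPDFReal 0 v (y + √v) := by
        rw [gaussianPDFReal, sub_zero, Real.sqrt_mul (by positivity), neg_div]
        have h3 : √(2 * Real.pi) ≤ 3 := by
          rw [Real.sqrt_le_left (by norm_num)]; nlinarith [Real.pi_lt_d2]
        have h0 : 0 < √(2 * Real.pi) := by positivity
        rw [mul_inv]
        calc _ = 3⁻¹ * Real.exp (-((y + √v) ^ 2 / (2 * v))) := by ring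
          _ ≤ (√(2 * Real.pi))⁻¹ * Real.exp (-((y + √v) ^ 2 / (2 * v))) := by gcongr
          _ = _ := by field_simp
    _ = ∫ _ in Set.Icc y (y + √v), gaussianPDFReal 0 v (y + √v) := by
        rw [setIntegral_const]
        simp [Measure.real, hs.le]
    _ ≤ ∫ u in Set.Icc y (y + √v), gaussianPDFReal 0 v u := by
        apply setIntegral_mono_on (by simp) (integrable_gaussianPDFReal 0 v).integrableOn
          measurableSet_Icc
        intro u hu
        unfold gaussianPDFReal
        have : 0 ≤ u := hy.trans hu.1
        gcongr
        exact hu.2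
    _ ≤ ∫ u in Set.Ici y, gaussianPDFReal 0 v u :=
        setIntegral_mono_set (integrable_gaussianPDFReal 0 v).integrableOn
          (ae_of_all _ fun u => gaussianPDFReal_nonneg 0 v u)
          (Set.Icc_subset_Ici_self.eventuallyLE)
    _ = _ := by
        rw [Measure.real, gaussianReal_apply_eq_integral 0 hv, ENNReal.toReal_ofReal]
        exact setIntegral_nonneg measurableSet_Ici fun u _ => gaussianPDFReal_nonneg 0 v u

end GaussianTail

/-! ### Small-ball estimate for Gaussian linear forms. -/

section LinearForms

variable {E : Type*} [NormedAddCommGroup E] [InnerProductSpace ℝ E] [FiniteDimensional ℝ E]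
  [MeasurableSpace E] [BorelSpace E]

/-- Small-ball estimate for the maximum of Gaussian linear forms `⟪b i, ·⟫` of common variance `V`
whose Gram matrix has norm at most `N * w`. -/
theorem stdGaussian_real_forall_inner_le {ι : Type*} (T : Finset ι) (b : ι → E) {N w V M σ : ℝ}
    (hw : 0 < w) (hV : 0 < V) (hM : 0 ≤ M) (hσ : 0 < σ) (hN : 0 < N)
    (hT : (T.card : ℝ) ≤ N) (hT2 : N ≤ 2 * T.card)
    (hb : ∀ i ∈ T, ‖b i‖ ^ 2 = V)
    (hB : ∀ c : ι → ℝ, ‖∑ i ∈ T, c i • b i‖ ^ 2 ≤ N * w * ∑ i ∈ T, c i ^ 2) :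
    (stdGaussian E).real {x | ∀ i ∈ T, inner ℝ (b i) x ≤ M} ≤
      Real.exp (-((σ * Real.exp (-((M + 2 * σ + √V) ^ 2 / (2 * V)))) ^ 2 / (180 * w))) := by
  set μ := stdGaussian E
  set q : ℝ := Real.exp (-((M + 2 * σ + √V) ^ 2 / (2 * V))) with hq
  let f : ι → E → ℝ := fun i x => smoothHinge ((inner ℝ (b i) x - M) / σ)
  let d : ι → E → ℝ := fun i x => max 0 (min ((inner ℝ (b i) x - M) / σ) 1)
  let Φ : E → ℝ := fun x => N⁻¹ * ∑ i ∈ T, σ * f i x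
  let Φ' : E → E := fun x => N⁻¹ • ∑ i ∈ T, d i x • b i
  have hΦ'c : Continuous Φ' := by unfold Φ' d; fun_prop
  have hdi : ∀ i x, HasGradientAt (fun x => σ * f i x) (d i x • b i) x := by
    intro i x
    have h1 : HasFDerivAt (fun x : E => (inner ℝ (b i) x - M) / σ) (σ⁻¹ • innerSL ℝ (b i)) x := by
      have := (((innerSL ℝ (b i)).hasFDerivAt (x := x)).sub_const M).const_mul σ⁻¹
      refine this.congr_of_eventuallyEq (Eventually.of_forall fun y => ?_)
      simp [div_eq_inv_mul]
    have h2 := ((hasDerivAt_smoothHinge ((inner ℝ (b i) x - M) / σ)).comp_hasFDerivAt x h1).const_mul σ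
    rw [hasGradientAt_iff_hasFDerivAt]
    convert! h2 using 1
    ext y
    simp [d]
    field_simp
  have hd : ∀ x, HasGradientAt Φ (Φ' x) x := by
    intro x
    rw [hasGradientAt_iff_hasFDerivAt]
    have := (HasFDerivAt.fun_sum (u := T) fun i _ => (hdi i x).hasFDerivAt).const_mul N⁻¹
    convert! this using 1
    simp [Φ']
  -- The weights d i x are hinge slopes in [0, 1], so their squares sum to at most N; the Gram bound
  -- does the rest.
  have hK : ∀ x, ‖Φ' x‖ ≤ √w := by
    intro x
    apply Real.le_sqrt_of_sq_le
    have h1 := hB fun i => d i x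
    have h2 : ∑ i ∈ T, d i x ^ 2 ≤ N := by
      refine le_trans ?_ hT
      calc _ ≤ ∑ i ∈ T, (1 : ℝ) := by
            apply Finset.sum_le_sum
            intro i _
            have h0 : 0 ≤ d i x := le_max_left _ _
            have h1 : d i x ≤ 1 := max_le zero_le_one (min_le_right _ _)
            exact pow_le_one₀ h0 h1
        _ = _ := by simp
    rw [norm_smul, mul_pow, norm_inv, Real.norm_of_nonneg hN.le]
    calc N⁻¹ ^ 2 * ‖∑ i ∈ T, d i x • b i‖ ^ 2 ≤ N⁻¹ ^ 2 * (N * w * N) := by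
          gcongr; exact h1.trans (by gcongr)
      _ = w := by field_simp
  have hmapV : ∀ i ∈ T, μ.map (fun x => inner ℝ (b i) x) = gaussianReal 0 V.toNNReal := by
    intro i hi
    rw [map_inner_stdGaussian]
    congr 1
    rw [← hb i hi]
    ext; simp
  have hVn : V.toNNReal ≠ 0 := by simpa using hV
  have hfi : ∀ i, Integrable (f i) μ := by
    intro i
    have hbound : ∀ z, smoothHinge z ≤ |z| := by
      intro z
      rcases le_total z 0 with h | h
      · rw [smoothHinge_of_nonpos h]; positivity
      · rw [abs_of_nonneg h]
        have hc : Continuous fun u : ℝ => max 0 (min u 1) := by fun_prop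
        calc smoothHinge z ≤ ∫ _ in (0 : ℝ)..z, (1 : ℝ) :=
              intervalIntegral.integral_mono_on h (hc.intervalIntegrable _ _) (by simp)
                fun u _ => max_le zero_le_one (min_le_right _ _)
          _ = z := by simp
    have hi : Integrable (fun x => (inner ℝ (b i) x - M) / σ) μ :=
      ((IsGaussian.integrable_dual μ (innerSL ℝ (b i))).sub (integrable_const M)).div_const σ
    refine hi.mono ?_ (ae_of_all _ fun x => ?_)
    · exact (continuous_smoothHinge.comp (by fun_prop)).aestronglyMeasurable
    · rw [Real.norm_of_nonneg (smoothHinge_nonneg _)]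
      exact hbound _
  have hEf : ∀ i ∈ T, q / 3 ≤ ∫ x, f i x ∂μ := by
    intro i hi
    have hS : MeasurableSet {x : E | M + 2 * σ ≤ inner ℝ (b i) x} :=
      measurableSet_le measurable_const (by fun_prop)
    calc q / 3 ≤ (gaussianReal 0 V.toNNReal).real (Set.Ici (M + 2 * σ)) := by
          have := exp_le_gaussianReal_real_Ici hVn (y := M + 2 * σ) (by positivity)
          rwa [Real.coe_toNNReal V hV.le] at this
      _ = μ.real {x | M + 2 * σ ≤ inner ℝ (b i) x} := by
          rw [← hmapV i hi, Measure.real, Measure.real,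
            Measure.map_apply (by fun_prop) measurableSet_Ici]
          rfl
      _ = ∫ x, Set.indicator {x | M + 2 * σ ≤ inner ℝ (b i) x} 1 x ∂μ := by
          rw [integral_indicator_one hS]
      _ ≤ _ := by
          apply integral_mono ((integrable_const 1).indicator hS) (hfi i)
          intro x
          by_cases hx : x ∈ {x | M + 2 * σ ≤ inner ℝ (b i) x}
          · rw [Set.indicator_of_mem hx]
            apply one_le_smoothHinge
            rw [le_div_iff₀ hσ]
            have : M + 2 * σ ≤ inner ℝ (b i) x := hx
            linarith
          · rw [Set.indicator_of_notMem hx]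
            exact smoothHinge_nonneg _
  have hΦi : Integrable Φ μ :=
    (integrable_finsetSum _ fun i _ => (hfi i).const_mul σ).const_mul _
  -- The 6 is 3, from the tail bound, times 2, from N ≤ 2 |T|.
  have hm : σ * q / 6 ≤ ∫ x, Φ x ∂μ := by
    have e : ∫ x, Φ x ∂μ = N⁻¹ * ∑ i ∈ T, σ * ∫ x, f i x ∂μ := by
      unfold Φ
      rw [integral_const_mul, integral_finsetSum _ fun i _ => (hfi i).const_mul σ]
      simp_rw [integral_const_mul]
    rw [e]
    have h1 : T.card * (σ * (q / 3)) ≤ ∑ i ∈ T, σ * ∫ x, f i x ∂μ := by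
      rw [← nsmul_eq_mul]
      apply Finset.card_nsmul_le_sum
      intro i hi
      gcongr
      exact hEf i hi
    have hq0 : 0 < q := Real.exp_pos _
    rw [inv_mul_eq_div, le_div_iff₀ hN]
    refine le_trans ?_ h1
    have : 0 ≤ σ * q := by positivity
    nlinarith
  have key := stdGaussian_real_le_zero_le hΦ'c hd hΦi (Real.sqrt_pos.2 hw) hK
    (m := σ * q / 6) (by positivity) hm
  calc μ.real {x | ∀ i ∈ T, inner ℝ (b i) x ≤ M} ≤ μ.real {x | Φ x ≤ 0} := by
        refine measureReal_mono (fun x hx => ?_) (measure_ne_top _ _)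
        have : Φ x = 0 := by
          unfold Φ
          rw [Finset.sum_eq_zero, mul_zero]
          intro i hi
          have h1 : f i x = 0 := smoothHinge_of_nonpos
            (div_nonpos_of_nonpos_of_nonneg (by have := hx i hi; linarith) hσ.le)
          rw [h1, mul_zero]
        exact this.le
    _ ≤ _ := key
    _ ≤ _ := by
        rw [Real.exp_le_exp, neg_le_neg_iff, Real.sq_sqrt hw.le]
        -- This gives the constant 180 = 2 · (5/2) · 6².
        have hpi : (Real.pi / 2) ^ 2 ≤ 5 / 2 := by nlinarith [Real.pi_lt_d2, Real.pi_pos]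
        calc (σ * q) ^ 2 / (180 * w) = (σ * q / 6) ^ 2 / (2 * (5 / 2) * w) := by
              field_simp; ring
          _ ≤ _ := by gcongr

end LinearForms

/-! ### Upper tail of weighted chi-square sums. -/

section ChiSquare

theorem integral_exp_sq_div_four_gaussianReal :
    ∫ x, Real.exp (x ^ 2 / 4) ∂gaussianReal 0 1 = √2 := by
  rw [integral_gaussianReal_eq_integral_smul one_ne_zero]
  have : ∀ x : ℝ, gaussianPDFReal 0 1 x • Real.exp (x ^ 2 / 4)
      = (√(2 * Real.pi))⁻¹ * Real.exp (-(1 / 4) * x ^ 2) := by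
    intro x
    simp only [gaussianPDFReal, NNReal.coe_one, mul_one, sub_zero, smul_eq_mul]
    rw [mul_assoc, ← Real.exp_add]
    ring_nf
  simp_rw [this]
  rw [integral_const_mul, integral_gaussian, ← Real.sqrt_inv, ← Real.sqrt_mul (by positivity)]
  congr 1
  have := Real.pi_pos
  field_simp
  norm_num

/-- The integral would take the default value 0 if integrability failed, but it equals √2. -/
theorem integrable_exp_sq_div_four_gaussianReal :
    Integrable (fun x : ℝ => Real.exp (x ^ 2 / 4)) (gaussianReal 0 1) := by
  by_contra h
  have := integral_exp_sq_div_four_gaussianReal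
  rw [integral_undef h] at this
  have h2 : (0 : ℝ) < √2 := by positivity
  linarith

theorem exp_mul_le_one_add {θ y : ℝ} (h0 : 0 ≤ θ) (h1 : θ ≤ 1) :
    Real.exp (θ * y) ≤ 1 + θ * (Real.exp y - 1) := by
  have := convexOn_exp.2 (Set.mem_univ y) (Set.mem_univ 0) h0 (sub_nonneg.2 h1) (by ring)
  simp only [smul_eq_mul, mul_zero, add_zero, Real.exp_zero, mul_one] at this
  linarith

theorem integrable_exp_mul_sq_gaussianReal {θ : ℝ} (h1 : θ ≤ 1) :
    Integrable (fun x : ℝ => Real.exp (θ * (x ^ 2 / 4))) (gaussianReal 0 1) := by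
  refine integrable_exp_sq_div_four_gaussianReal.mono (by fun_prop) (ae_of_all _ fun x => ?_)
  rw [Real.norm_of_nonneg (Real.exp_pos _).le, Real.norm_of_nonneg (Real.exp_pos _).le,
    Real.exp_le_exp]
  exact mul_le_of_le_one_left (by positivity) h1

/-- Convexity in θ reduces the claim to the exact value √2 at θ = 1, and √2 - 1 ≤ 1. -/
theorem integral_exp_mul_sq_gaussianReal_le {θ : ℝ} (h0 : 0 ≤ θ) (h1 : θ ≤ 1) :
    ∫ x, Real.exp (θ * (x ^ 2 / 4)) ∂gaussianReal 0 1 ≤ Real.exp θ := by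
  have hi := integrable_exp_sq_div_four_gaussianReal
  have hi1 : Integrable (fun x : ℝ => Real.exp (x ^ 2 / 4) - 1) (gaussianReal 0 1) :=
    hi.sub (integrable_const 1)
  calc _ ≤ ∫ x, (1 + θ * (Real.exp (x ^ 2 / 4) - 1)) ∂gaussianReal 0 1 :=
        integral_mono (integrable_exp_mul_sq_gaussianReal h1)
          ((integrable_const 1).add (hi1.const_mul θ)) fun x => exp_mul_le_one_add h0 h1
    _ = 1 + θ * (√2 - 1) := by
        rw [integral_add (integrable_const 1) (hi1.const_mul θ), integral_const_mul,
          integral_sub hi (integrable_const 1), integral_exp_sq_div_four_gaussianReal]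
        simp
    _ ≤ 1 + θ := by
        have : √2 ≤ 2 := by rw [Real.sqrt_le_left] <;> norm_num
        nlinarith
    _ ≤ Real.exp θ := by linarith [Real.add_one_le_exp θ]

variable {Ω κ : Type*} [MeasurableSpace Ω] {P : Measure Ω} [IsProbabilityMeasure P]
  {f : κ → Ω → ℝ}

/-- Upper tail of a weighted sum of squares of independent standard Gaussian variables. -/
theorem real_lt_sum_mul_sq_le (hlaw : ∀ k, HasLaw (f k) (gaussianReal 0 1) P) (hf : iIndepFun f P)
    (D : Finset κ) {d : κ → ℝ} {β u m : ℝ} (hβ : 0 < β) (hd0 : ∀ k ∈ D, 0 ≤ d k)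
    (hd : ∀ k ∈ D, d k ≤ β) (hm : ∑ k ∈ D, d k ≤ m) :
    P.real {ω | u < ∑ k ∈ D, d k * f k ω ^ 2} ≤ Real.exp (-(u / (4 * β)) + m / β) := by
  classical
  let Y : κ → Ω → ℝ := fun k ω => d k * f k ω ^ 2
  have hfm : ∀ k, AEMeasurable (f k) P := fun k => (hlaw k).aemeasurable
  have hYm : ∀ k, AEMeasurable (Y k) P := fun k => ((hfm k).pow_const 2).const_mul _
  have hY : iIndepFun Y P := hf.comp (fun k x => d k * x ^ 2) fun k => by fun_prop
  have hθ : ∀ k ∈ D, 0 ≤ d k / β ∧ d k / β ≤ 1 := fun k hk =>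
    ⟨div_nonneg (hd0 k hk) hβ.le, (div_le_one hβ).2 (hd k hk)⟩
  have he : ∀ k x, Real.exp (1 / (4 * β) * (d k * x ^ 2)) = Real.exp (d k / β * (x ^ 2 / 4)) := by
    intro k x
    congr 1
    field_simp
  have hmgf : ∀ k ∈ D, mgf (Y k) P (1 / (4 * β)) ≤ Real.exp (d k / β) := by
    intro k hk
    have : mgf (Y k) P (1 / (4 * β)) = ∫ x, Real.exp (d k / β * (x ^ 2 / 4)) ∂gaussianReal 0 1 := by
      rw [← (hlaw k).integral_comp (by fun_prop)]
      simp only [mgf, Y, he, Function.comp_def]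
    rw [this]
    exact integral_exp_mul_sq_gaussianReal_le (hθ k hk).1 (hθ k hk).2
  -- The same device: an undefined `mgf` would be 0, whereas it is a product of positive factors.
  have hint : Integrable (fun ω => Real.exp (1 / (4 * β) * (∑ k ∈ D, Y k) ω)) P := by
    by_contra hni
    have h0 : mgf (∑ k ∈ D, Y k) P (1 / (4 * β)) = 0 := mgf_undef hni
    rw [hY.mgf_sum₀ hYm] at h0
    refine (Finset.prod_pos fun k hk => mgf_pos ?_).ne' h0
    have h1 := integrable_exp_mul_sq_gaussianReal (hθ k hk).2
    rw [← (hlaw k).map_eq, integrable_map_measure (by fun_prop) (hfm k)] at h1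
    simp only [Y, he]
    exact h1
  calc P.real {ω | u < ∑ k ∈ D, d k * f k ω ^ 2} ≤ P.real {ω | u ≤ (∑ k ∈ D, Y k) ω} := by
        refine measureReal_mono (fun ω hω => ?_) (measure_ne_top _ _)
        simp only [Set.mem_ofPred_eq, Finset.sum_apply] at hω ⊢
        exact hω.le
    _ ≤ Real.exp (-(1 / (4 * β)) * u) * mgf (∑ k ∈ D, Y k) P (1 / (4 * β)) :=
        measure_ge_le_exp_mul_mgf u (by positivity) hint
    _ ≤ Real.exp (-(1 / (4 * β)) * u) * Real.exp (m / β) := by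
        gcongr
        rw [hY.mgf_sum₀ hYm]
        calc _ ≤ ∏ k ∈ D, Real.exp (d k / β) :=
              Finset.prod_le_prod (fun _ _ => mgf_nonneg) hmgf
          _ = Real.exp (∑ k ∈ D, d k / β) := (Real.exp_sum _ _).symm
          _ ≤ _ := by
              rw [← Finset.sum_div]
              gcongr
    _ = _ := by rw [← Real.exp_add]; congr 1; ring

end ChiSquare

/-! ### Conditioning on an independent perturbation. -/

section Splitting

variable {Ω κ ι : Type*} [MeasurableSpace Ω] {P : Measure Ω} [IsProbabilityMeasure P]
  {f : κ → Ω → ℝ} [Fintype ι]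

/-- The restriction of an i.i.d. standard Gaussian family to a finite set of indices. -/
theorem map_toLp_eq_stdGaussian (hlaw : ∀ k, HasLaw (f k) (gaussianReal 0 1) P)
    (hf : iIndepFun f P) (S : Finset κ) :
    P.map (fun ω => WithLp.toLp 2 fun s : S => f s ω) = stdGaussian (EuclideanSpace ℝ S) := by
  classical
  have hfm : ∀ k, AEMeasurable (f k) P := fun k => (hlaw k).aemeasurable
  have h1 : iIndepFun (fun (s : S) => f s) P := hf.precomp Subtype.val_injective
  rw [iIndepFun_iff_map_fun_eq_pi_map fun s : S => hfm s] at h1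
  simp_rw [(hlaw _).map_eq] at h1
  rw [← map_pi_eq_stdGaussian, ← h1, AEMeasurable.map_map_of_aemeasurable]
  · rfl
  · exact (by fun_prop : Measurable (WithLp.toLp 2 : (S → ℝ) → EuclideanSpace ℝ S)).aemeasurable
  · exact aemeasurable_pi_lambda _ fun s : S => hfm s

/-- Small-ball estimate for the maximum of Gaussian linear forms, in which an independent part
of small mean square is treated as a perturbation. -/
theorem real_forall_sum_le (hlaw : ∀ k, HasLaw (f k) (gaussianReal 0 1) P) (hf : iIndepFun f P)
    [Nonempty ι] {S D : Finset κ} (hSD : Disjoint S D) (b : ι → κ → ℝ) {d : κ → ℝ}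
    {w V M u σ : ℝ} (hw : 0 < w) (hV : 0 < V) (hM : 0 ≤ M) (hu : 0 < u) (hσ : 0 < σ)
    (hb : ∀ i, ∑ s ∈ S, b i s ^ 2 = V)
    (hB : ∀ c : ι → ℝ, ∑ s ∈ S, (∑ i, c i * b i s) ^ 2 ≤ Fintype.card ι * w * ∑ i, c i ^ 2)
    (hD : ∀ v : κ → ℝ, ∑ i, (∑ s ∈ D, b i s * v s) ^ 2 ≤ Fintype.card ι * ∑ s ∈ D, d s * v s ^ 2) :
    P.real {ω | ∀ i, ∑ s ∈ S, b i s * f s ω + ∑ s ∈ D, b i s * f s ω ≤ M} ≤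
      P.real {ω | u < ∑ s ∈ D, d s * f s ω ^ 2} +
      Real.exp (-((σ * Real.exp (-((M + √(2 * u) + 2 * σ + √V) ^ 2 / (2 * V)))) ^ 2 / (180 * w)))
      := by
  classical
  set R := Real.exp (-((σ * Real.exp (-((M + √(2 * u) + 2 * σ + √V) ^ 2 / (2 * V)))) ^ 2
    / (180 * w))) with hR
  have hfm : ∀ k, AEMeasurable (f k) P := fun k => (hlaw k).aemeasurable
  let N : ℝ := Fintype.card ι
  have hN : 0 < N := by unfold N; exact_mod_cast Fintype.card_pos
  let US : Ω → EuclideanSpace ℝ S := fun ω => WithLp.toLp 2 fun s : S => f s ω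
  let UD : Ω → D → ℝ := fun ω s => f s ω
  have hUS : AEMeasurable US P :=
    (by fun_prop : Measurable (WithLp.toLp 2 : (S → ℝ) → EuclideanSpace ℝ S)).comp_aemeasurable
      (aemeasurable_pi_lambda _ fun s : S => hfm s)
  have hUD : AEMeasurable UD P := aemeasurable_pi_lambda _ fun s : D => hfm s
  have hind : IndepFun US UD P :=
    (hf.indepFun_finset₀ S D hSD hfm).comp
      (by fun_prop : Measurable (WithLp.toLp 2 : (S → ℝ) → EuclideanSpace ℝ S)) measurable_id
  have hprod : P.map (fun ω => (US ω, UD ω)) = (stdGaussian (EuclideanSpace ℝ S)).prod (P.map UD) := by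
    rw [(indepFun_iff_map_prod_eq_prod_map_map hUS hUD).1 hind]
    congr 1
    exact map_toLp_eq_stdGaussian hlaw hf S
  have : IsProbabilityMeasure (P.map UD) := Measure.isProbabilityMeasure_map hUD
  let e : ι → EuclideanSpace ℝ S := fun i => WithLp.toLp 2 fun s : S => b i s
  let h : ι → (D → ℝ) → ℝ := fun i y => ∑ s : D, b i s * y s
  let Q : (D → ℝ) → ℝ := fun y => ∑ s : D, d s * y s ^ 2
  let A : Set (EuclideanSpace ℝ S × (D → ℝ)) :=
    {p | (∀ i, inner ℝ (e i) p.1 + h i p.2 ≤ M) ∧ Q p.2 ≤ u}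
  have hA : MeasurableSet A := by
    have : A = (⋂ i, {p | inner ℝ (e i) p.1 + h i p.2 ≤ M}) ∩ {p | Q p.2 ≤ u} := by
      ext p; simp [A]
    rw [this]
    refine MeasurableSet.inter (MeasurableSet.iInter fun i => ?_) ?_
    · exact measurableSet_le (by fun_prop) measurable_const
    · exact measurableSet_le (by fun_prop) measurable_const
  have hinner : ∀ i ω, inner ℝ (e i) (US ω) = ∑ s ∈ S, b i s * f s ω := by
    intro i ω
    rw [PiLp.inner_apply, ← Finset.sum_coe_sort S]
    simp [e, US, mul_comm]
  have hh : ∀ i ω, h i (UD ω) = ∑ s ∈ D, b i s * f s ω := by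
    intro i ω
    rw [← Finset.sum_coe_sort D]
  have hQ : ∀ ω, Q (UD ω) = ∑ s ∈ D, d s * f s ω ^ 2 := by
    intro ω
    rw [← Finset.sum_coe_sort D]
  have hen : ∀ i, ‖e i‖ ^ 2 = V := by
    intro i
    rw [EuclideanSpace.real_norm_sq_eq, ← hb i, ← Finset.sum_coe_sort S]
  -- The perturbation is frozen at y; the bound is uniform in y, so Fubini finishes.
  have hslice : ∀ y : D → ℝ,
      stdGaussian (EuclideanSpace ℝ S) ((fun x => (x, y)) ⁻¹' A) ≤ ENNReal.ofReal R := by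
    intro y
    by_cases hy : Q y ≤ u
    swap
    · have : (fun x : EuclideanSpace ℝ S => (x, y)) ⁻¹' A = ∅ := by
        ext x; simp [A, hy]
      simp [this]
    -- Since the mean square of h i y over i is at most u, Chebyshev's inequality leaves at least
    -- half of the indices in T.
    let T : Finset ι := {i | |h i y| ≤ √(2 * u)}
    have hT1 : (T.card : ℝ) ≤ N := Nat.cast_le.2 (Finset.card_le_univ T)
    have hT2 : N ≤ 2 * T.card := by
      have h1 : ∑ i, h i y ^ 2 ≤ N * u := by
        have := hD fun s => if hs : s ∈ D then y ⟨s, hs⟩ else 0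
        refine le_trans (le_of_eq ?_) (this.trans (le_trans (le_of_eq ?_)
          (mul_le_mul_of_nonneg_left hy hN.le)))
        · refine Finset.sum_congr rfl fun i _ => ?_
          rw [← Finset.sum_coe_sort D]
          simp [h]
        · rw [← Finset.sum_coe_sort D]
          simp [Q, N]
      have h2 : (Tᶜ.card : ℝ) * (2 * u) ≤ ∑ i, h i y ^ 2 := by
        calc (Tᶜ.card : ℝ) * (2 * u) = ∑ i ∈ Tᶜ, 2 * u := by simp
          _ ≤ ∑ i ∈ Tᶜ, h i y ^ 2 := by
              refine Finset.sum_le_sum fun i hi => ?_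
              simp only [T, Finset.compl_filter, Finset.mem_filter, not_le] at hi
              rw [← sq_abs, ← Real.sq_sqrt (by positivity : 0 ≤ 2 * u)]
              exact pow_le_pow_left₀ (Real.sqrt_nonneg _) hi.2.le 2
          _ ≤ _ := Finset.sum_le_univ_sum_of_nonneg fun i => sq_nonneg _
      have h3 : (Tᶜ.card : ℝ) = N - T.card := by
        rw [Finset.card_compl, Nat.cast_sub (Finset.card_le_univ T)]
      rw [h3] at h2
      have h4 : (N - T.card) * 2 * u ≤ N * u := by linarith
      have := le_of_mul_le_mul_right h4 hu
      linarith
    have hB' : ∀ c : ι → ℝ, ‖∑ i ∈ T, c i • e i‖ ^ 2 ≤ N * w * ∑ i ∈ T, c i ^ 2 := by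
      intro c
      have := hB fun i => if i ∈ T then c i else 0
      refine le_trans (le_of_eq ?_) (this.trans (le_of_eq ?_))
      · rw [EuclideanSpace.real_norm_sq_eq, ← Finset.sum_coe_sort S]
        simp [e, ite_mul, Finset.sum_ite_mem]
      · simp [N, ite_pow, Finset.sum_ite_mem]
    have key := stdGaussian_real_forall_inner_le T e (M := M + √(2 * u)) hw hV (by positivity) hσ hN
      hT1 hT2 (fun i _ => hen i) hB'
    have hsub : (fun x : EuclideanSpace ℝ S => (x, y)) ⁻¹' A ⊆
        {x | ∀ i ∈ T, inner ℝ (e i) x ≤ M + √(2 * u)} := by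
      intro x hx i hi
      have h1 := hx.1 i
      simp only [T, Finset.mem_filter] at hi
      have h2 := neg_le_of_abs_le hi.2
      simp only at h1
      linarith
    refine (measure_mono hsub).trans ?_
    rw [← ENNReal.ofReal_toReal (measure_ne_top _ _)]
    exact ENNReal.ofReal_le_ofReal key
  have hPA : P.real {ω | (US ω, UD ω) ∈ A} ≤ R := by
    apply ENNReal.toReal_le_of_le_ofReal (Real.exp_pos _).le
    have h1 : P {ω | (US ω, UD ω) ∈ A} = (P.map (fun ω => (US ω, UD ω))) A :=
      (Measure.map_apply_of_aemeasurable (hUS.prodMk hUD) hA).symm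
    rw [h1, hprod, Measure.prod_apply_symm hA]
    calc _ ≤ ∫⁻ _, ENNReal.ofReal R ∂(P.map UD) := lintegral_mono hslice
      _ = _ := by rw [lintegral_const, measure_univ, mul_one]
  calc _ ≤ P.real ({ω | u < ∑ s ∈ D, d s * f s ω ^ 2} ∪ {ω | (US ω, UD ω) ∈ A}) := by
        refine measureReal_mono (fun ω hω => ?_) (measure_ne_top _ _)
        rcases lt_or_ge u (∑ s ∈ D, d s * f s ω ^ 2) with hlt | hge
        · exact Or.inl hlt
        · refine Or.inr ⟨fun i => ?_, ?_⟩
          · simp only [hinner, hh]; exact hω i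
          · simp only [hQ]; exact hge
    _ ≤ _ := (measureReal_union_le _ _).trans (by gcongr)

end Splitting

/-! ### Orthogonality of characters on a grid. -/

section TrigSums

variable {n : ℕ} {J : Finset ℕ} {l : ℕ → ℤ}

theorem sum_exp_two_pi_eq_zero {q : ℤ} (hn : 0 < n) (hq : ¬ (n : ℤ) ∣ q) :
    ∑ i : Fin n, Complex.exp ((2 * Real.pi * q * (i / n) : ℝ) * Complex.I) = 0 := by
  have hn0 : (n : ℂ) ≠ 0 := by exact_mod_cast hn.ne'
  set ζ : ℂ := Complex.exp (2 * Real.pi * q / n * Complex.I) with hζ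
  have h1 : ∀ i : ℕ, Complex.exp ((2 * Real.pi * q * (i / n) : ℝ) * Complex.I) = ζ ^ i := by
    intro i
    rw [hζ, ← Complex.exp_nat_mul]
    congr 1
    push_cast
    ring
  simp_rw [h1]
  rw [Fin.sum_univ_eq_sum_range (fun i => ζ ^ i) n]
  have hne : ζ ≠ 1 := by
    rw [hζ, Ne, Complex.exp_eq_one_iff]
    rintro ⟨m, hm⟩
    apply hq
    refine ⟨m, ?_⟩
    have h2 : (q : ℂ) = n * m := by
      have : (2 * Real.pi * Complex.I : ℂ) ≠ 0 := Complex.two_pi_I_ne_zero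
      field_simp at hm
      exact hm
    exact_mod_cast h2
  have hpow : ζ ^ n = 1 := by
    rw [hζ, ← Complex.exp_nat_mul, Complex.exp_eq_one_iff]
    exact ⟨q, by field_simp⟩
  have := mul_geom_sum ζ n
  rw [hpow, sub_self] at this
  exact (mul_eq_zero.1 this).resolve_left (sub_ne_zero.2 hne)

/-- The normalized character `i ↦ exp (2 π i q (i / n)) / √n` on `n` equally spaced points. -/
noncomputable def gridChar (n : ℕ) (q : ℤ) : EuclideanSpace ℂ (Fin n) :=
  WithLp.toLp 2 fun i => (√n : ℂ)⁻¹ * Complex.exp ((2 * Real.pi * q * (i / n) : ℝ) * Complex.I)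

theorem inner_gridChar (p q : ℤ) :
    inner ℂ (gridChar n p) (gridChar n q) = (n : ℂ)⁻¹ *
      ∑ i : Fin n, Complex.exp ((2 * Real.pi * (q - p : ℤ) * (i / n) : ℝ) * Complex.I) := by
  have hs : ((√n : ℝ) : ℂ) * ((√n : ℝ) : ℂ) = n := by
    rw [← Complex.ofReal_mul, Real.mul_self_sqrt (Nat.cast_nonneg n)]; simp
  rw [PiLp.inner_apply, Finset.mul_sum]
  refine Finset.sum_congr rfl fun i _ => ?_
  simp only [gridChar, RCLike.inner_apply, map_mul, map_inv₀, Complex.conj_ofReal,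
    ← Complex.exp_conj, Complex.conj_I]
  rw [mul_mul_mul_comm, ← mul_inv, hs, ← Complex.exp_add]
  congr 2
  push_cast
  ring

theorem orthonormal_gridChar (hn : 0 < n)
    (hl : ∀ k ∈ J, ∀ k' ∈ J, k ≠ k' → ¬ (n : ℤ) ∣ l k - l k') :
    Orthonormal ℂ fun k : J => gridChar n (l k) := by
  classical
  have hn0 : (n : ℂ) ≠ 0 := by exact_mod_cast hn.ne'
  rw [orthonormal_iff_ite]
  intro k k'
  rw [inner_gridChar]
  split_ifs with h
  · subst h
    simp [hn0]
  · rw [sum_exp_two_pi_eq_zero hn (hl k' k'.2 k k.2 fun e => h (Subtype.ext e.symm)), mul_zero]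

theorem norm_sq_inner_gridChar (hn : 0 < n) (q : ℤ) (c : Fin n → ℝ) :
    n * ‖inner ℂ (gridChar n q) (WithLp.toLp 2 fun i => (c i : ℂ))‖ ^ 2 =
      (∑ i, c i * Real.cos (2 * Real.pi * q * (i / n))) ^ 2 +
        (∑ i, c i * Real.sin (2 * Real.pi * q * (i / n))) ^ 2 := by
  have hs : (√n : ℝ) ^ 2 = n := Real.sq_sqrt (Nat.cast_nonneg n)
  have h1 : inner ℂ (gridChar n q) (WithLp.toLp 2 fun i => (c i : ℂ)) = ((√n)⁻¹ : ℝ) *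
      ((∑ i, c i * Real.cos (2 * Real.pi * q * (i / n)) : ℝ) -
        (∑ i, c i * Real.sin (2 * Real.pi * q * (i / n)) : ℝ) * Complex.I) := by
    rw [PiLp.inner_apply]
    simp only [Complex.ofReal_sum, Finset.sum_mul]
    rw [← Finset.sum_sub_distrib, Finset.mul_sum]
    refine Finset.sum_congr rfl fun i _ => ?_
    simp only [gridChar, RCLike.inner_apply, Complex.exp_mul_I, map_mul, map_inv₀,
      Complex.conj_ofReal, map_add, Complex.conj_I, ← Complex.ofReal_cos, ← Complex.ofReal_sin]
    push_cast
    ring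
  rw [h1, ← Complex.normSq_eq_norm_sq, map_mul, Complex.normSq_ofReal, sub_eq_add_neg,
    ← neg_mul, ← Complex.ofReal_neg, Complex.normSq_add_mul_I, neg_sq, ← mul_assoc]
  have h2 : (n : ℝ) * ((√n)⁻¹ * (√n)⁻¹) = 1 := by
    rw [← mul_inv, ← sq, hs, mul_inv_cancel₀ (by exact_mod_cast hn.ne')]
  rw [h2, one_mul]

/-- Bessel's inequality on the grid, in real form. -/
theorem sum_sq_trig_le (hn : 0 < n)
    (hl : ∀ k ∈ J, ∀ k' ∈ J, k ≠ k' → ¬ (n : ℤ) ∣ l k - l k') (c : Fin n → ℝ) :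
    ∑ k ∈ J, ((∑ i, c i * Real.cos (2 * Real.pi * l k * (i / n))) ^ 2 +
      (∑ i, c i * Real.sin (2 * Real.pi * l k * (i / n))) ^ 2) ≤ n * ∑ i, c i ^ 2 := by
  have h := (orthonormal_gridChar hn hl).sum_inner_products_le (s := Finset.univ)
    (WithLp.toLp 2 fun i => (c i : ℂ))
  rw [EuclideanSpace.norm_sq_eq] at h
  simp only [Complex.norm_real, Real.norm_eq_abs, sq_abs] at h
  simp_rw [← norm_sq_inner_gridChar hn]
  rw [← Finset.mul_sum, ← Finset.sum_coe_sort J]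
  gcongr

/-- The mean square of a trigonometric polynomial over the grid. -/
theorem sum_trig_sq_le (hn : 0 < n)
    (hl : ∀ k ∈ J, ∀ k' ∈ J, k ≠ k' → ¬ (n : ℤ) ∣ l k - l k') (v v' : ℕ → ℝ) :
    ∑ i : Fin n, (∑ k ∈ J, (v k * Real.cos (2 * Real.pi * l k * (i / n)) +
      v' k * Real.sin (2 * Real.pi * l k * (i / n)))) ^ 2 ≤ n * ∑ k ∈ J, (v k ^ 2 + v' k ^ 2) := by
  have hs : (√n : ℝ) ^ 2 = n := Real.sq_sqrt (Nat.cast_nonneg n)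
  -- Chosen so that Re (z k · exp (iφ)) = v k cos φ + v' k sin φ. Orthonormality gives the norm of
  -- y, and passing to real parts only decreases it.
  let z : J → ℂ := fun k => v k - v' k * Complex.I
  let y : EuclideanSpace ℂ (Fin n) := ∑ k : J, z k • gridChar n (l k)
  have hy : ‖y‖ ^ 2 = ∑ k ∈ J, (v k ^ 2 + v' k ^ 2) := by
    have h1 := (orthonormal_gridChar hn hl).inner_sum z z Finset.univ
    have h2 : ((‖y‖ ^ 2 : ℝ) : ℂ) = ((∑ k ∈ J, (v k ^ 2 + v' k ^ 2) : ℝ) : ℂ) := by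
      have h3 := inner_self_eq_norm_sq_to_K (𝕜 := ℂ) y
      rw [show inner ℂ y y = _ from h1] at h3
      push_cast
      refine h3.symm.trans ?_
      rw [← Finset.sum_coe_sort J]
      refine Finset.sum_congr rfl fun k _ => ?_
      simp only [z, map_sub, map_mul, Complex.conj_ofReal, Complex.conj_I]
      ring_nf
      simp
    exact_mod_cast h2
  rw [← hy, EuclideanSpace.norm_sq_eq, Finset.mul_sum]
  refine Finset.sum_le_sum fun i _ => ?_
  have hre : (y i).re = (√n)⁻¹ * ∑ k ∈ J, (v k * Real.cos (2 * Real.pi * l k * (i / n)) +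
      v' k * Real.sin (2 * Real.pi * l k * (i / n))) := by
    simp only [y, WithLp.ofLp_sum, WithLp.ofLp_smul, Finset.sum_apply, Pi.smul_apply, smul_eq_mul,
      Complex.re_sum, Finset.mul_sum]
    rw [← Finset.sum_coe_sort J]
    refine Finset.sum_congr rfl fun k _ => ?_
    simp only [gridChar, z, Complex.exp_mul_I, ← Complex.ofReal_cos, ← Complex.ofReal_sin,
      ← Complex.ofReal_inv]
    generalize Real.cos _ = C
    generalize (√(n : ℝ))⁻¹ = r
    generalize Real.sin _ = S
    simp
    ring
  have h1 : (y i).re ^ 2 ≤ ‖y i‖ ^ 2 := by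
    rw [← sq_abs]
    exact pow_le_pow_left₀ (abs_nonneg _) (Complex.abs_re_le_norm _) 2
  rw [hre, mul_pow, inv_pow, hs, inv_mul_eq_div, div_le_iff₀ (by exact_mod_cast hn)] at h1
  linarith

end TrigSums

/-! ### Small-ball estimate for the random trigonometric sum on a grid. -/

section RandomTrig

variable {Ω : Type*} [MeasurableSpace Ω] {P : Measure Ω} [IsProbabilityMeasure P]
  {g g' : ℕ → Ω → ℝ}

/-- Small-ball estimate on a grid, the coefficients being split into a part with small coefficients
(index set `J`) and a part with small total variance (index set `K`). -/
theorem real_forall_trig_le (hg : GaussTrig.IsStdNormalPair P g g') {n : ℕ} (hn : 0 < n)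
    {J K : Finset ℕ} (hJK : Disjoint J K) {l : ℕ → ℤ}
    (hlJ : ∀ k ∈ J, ∀ k' ∈ J, k ≠ k' → ¬ (n : ℤ) ∣ l k - l k')
    (hlK : ∀ k ∈ K, ∀ k' ∈ K, k ≠ k' → ¬ (n : ℤ) ∣ l k - l k')
    (α : ℕ → ℝ) {w β m M u σ : ℝ} (hw : 0 < w) (hβ : 0 < β) (hM : 0 ≤ M) (hu : 0 < u) (hσ : 0 < σ)
    (hαJ : ∀ k ∈ J, α k ^ 2 ≤ w) (hαK : ∀ k ∈ K, α k ^ 2 ≤ β) (hm : ∑ k ∈ K, α k ^ 2 ≤ m)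
    (hV : 0 < ∑ k ∈ J, α k ^ 2) :
    P.real {ω | ∀ i : Fin n, ∑ k ∈ J ∪ K, α k * (g (k + 1) ω * Real.cos (2 * Real.pi * l k * (i / n))
        + g' (k + 1) ω * Real.sin (2 * Real.pi * l k * (i / n))) ≤ M} ≤
      Real.exp (-(u / (4 * β)) + 2 * m / β) +
      Real.exp (-((σ * Real.exp (-((M + √(2 * u) + 2 * σ + √(∑ k ∈ J, α k ^ 2)) ^ 2 /
        (2 * ∑ k ∈ J, α k ^ 2)))) ^ 2 / (180 * w))) := by
  let f : ℕ ⊕ ℕ → Ω → ℝ := Sum.elim (fun k => g (k + 1)) fun k => g' (k + 1)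
  have hlaw : ∀ s, HasLaw (f s) (gaussianReal 0 1) P := by
    rintro (k | k)
    · exact hg.hasLaw_left _ (by omega)
    · exact hg.hasLaw_right _ (by omega)
  let b : Fin n → ℕ ⊕ ℕ → ℝ := fun i => Sum.elim
    (fun k => α k * Real.cos (2 * Real.pi * l k * (i / n)))
    fun k => α k * Real.sin (2 * Real.pi * l k * (i / n))
  let d : ℕ ⊕ ℕ → ℝ := Sum.elim (fun k => α k ^ 2) fun k => α k ^ 2
  have : Nonempty (Fin n) := ⟨⟨0, hn⟩⟩
  have hdisj : Disjoint (J.disjSum J) (K.disjSum K) := by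
    rw [Finset.disjoint_left] at hJK ⊢
    rintro (k | k) h1 h2
    · exact hJK (Finset.inl_mem_disjSum.1 h1) (Finset.inl_mem_disjSum.1 h2)
    · exact hJK (Finset.inr_mem_disjSum.1 h1) (Finset.inr_mem_disjSum.1 h2)
  have main := real_forall_sum_le hlaw hg.indep hdisj b (d := d) (M := M) (u := u) hw hV hM hu hσ
    (fun i => by
      rw [Finset.sum_disjSum, ← Finset.sum_add_distrib]
      refine Finset.sum_congr rfl fun k _ => ?_
      simp only [b, Sum.elim_inl, Sum.elim_inr]
      rw [mul_pow, mul_pow, ← mul_add, Real.cos_sq_add_sin_sq, mul_one])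
    (fun c => by
      have h := sum_sq_trig_le hn hlJ c
      rw [Finset.sum_disjSum, ← Finset.sum_add_distrib, Fintype.card_fin]
      calc _ = ∑ k ∈ J, α k ^ 2 * ((∑ i, c i * Real.cos (2 * Real.pi * l k * (i / n))) ^ 2 +
            (∑ i, c i * Real.sin (2 * Real.pi * l k * (i / n))) ^ 2) := by
            refine Finset.sum_congr rfl fun k _ => ?_
            simp only [b, Sum.elim_inl, Sum.elim_inr, mul_left_comm (c _) (α k), ← Finset.mul_sum]
            ring
        _ ≤ ∑ k ∈ J, w * ((∑ i, c i * Real.cos (2 * Real.pi * l k * (i / n))) ^ 2 +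
            (∑ i, c i * Real.sin (2 * Real.pi * l k * (i / n))) ^ 2) := by
            refine Finset.sum_le_sum fun k hk => ?_
            gcongr
            exact hαJ k hk
        _ ≤ w * (n * ∑ i, c i ^ 2) := by
            rw [← Finset.mul_sum]
            gcongr
        _ = _ := by ring)
    (fun v => by
      have h := sum_trig_sq_le hn hlK (fun k => α k * v (Sum.inl k)) fun k => α k * v (Sum.inr k)
      simp only [Finset.sum_disjSum, ← Finset.sum_add_distrib, Fintype.card_fin]
      refine le_trans (le_of_eq ?_) (h.trans (le_of_eq ?_))
      · refine Finset.sum_congr rfl fun i _ => ?_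
        congr 1
        refine Finset.sum_congr rfl fun k _ => ?_
        simp only [b, Sum.elim_inl, Sum.elim_inr]
        ring
      · congr 1
        refine Finset.sum_congr rfl fun k _ => ?_
        simp only [d, Sum.elim_inl, Sum.elim_inr]
        ring)
  have tail := real_lt_sum_mul_sq_le hlaw hg.indep (K.disjSum K) (d := d) (β := β) (u := u)
    (m := 2 * m) hβ
    (by rintro (k | k) _ <;> exact sq_nonneg _)
    (by
      rintro (k | k) h
      · exact hαK k (Finset.inl_mem_disjSum.1 h)
      · exact hαK k (Finset.inr_mem_disjSum.1 h))
    (by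
      rw [Finset.sum_disjSum]
      simp only [d, Sum.elim_inl, Sum.elim_inr]
      linarith)
  refine le_trans (le_of_eq ?_) (main.trans (by gcongr))
  congr 1
  ext ω
  refine forall_congr' fun i => ?_
  rw [Finset.sum_union hJK]
  simp only [Finset.sum_disjSum, ← Finset.sum_add_distrib, b, f, Sum.elim_inl, Sum.elim_inr]
  simp only [mul_add, mul_assoc, mul_comm (Real.cos _), mul_comm (Real.sin _)]

end RandomTrig

/-! ### Choice of parameters and asymptotics. -/

section Asymptotics

theorem exists_forall_not_dvd_sub {l : ℕ → ℤ} (hl : Function.Injective l) (s : Finset ℕ) :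
    ∃ n : ℕ, 0 < n ∧ ∀ k ∈ s, ∀ k' ∈ s, k ≠ k' → ¬ (n : ℤ) ∣ l k - l k' := by
  -- This modulus exceeds every |l k - l k'|, so it divides no nonzero difference.
  refine ⟨∑ k ∈ s, ∑ k' ∈ s, (l k - l k').natAbs + 1, by omega, fun k hk k' hk' hne hd => ?_⟩
  have h0 : (l k - l k').natAbs ≠ 0 := by
    rw [Int.natAbs_ne_zero, sub_ne_zero]
    exact fun h => hne (hl h)
  have h1 := Nat.le_of_dvd (Nat.pos_of_ne_zero h0) (Int.natCast_dvd.1 hd)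
  have h2 : (l k - l k').natAbs ≤ ∑ k' ∈ s, (l k - l k').natAbs :=
    Finset.single_le_sum (f := fun k' => (l k - l k').natAbs) (fun _ _ => Nat.zero_le _) hk'
  have h3 : ∑ k' ∈ s, (l k - l k').natAbs ≤ ∑ k ∈ s, ∑ k' ∈ s, (l k - l k').natAbs :=
    Finset.single_le_sum (f := fun k => ∑ k' ∈ s, (l k - l k').natAbs) (fun _ _ => Nat.zero_le _) hk
  omega

theorem sum_Icc_one_eq_sum_range (F : ℕ → ℝ) (N : ℕ) :
    ∑ k ∈ Finset.Icc 1 N, F k = ∑ k ∈ Finset.range N, F (k + 1) := by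
  induction N with
  | zero => simp
  | succ N ih => rw [Finset.sum_Icc_succ_top (by omega), ih, Finset.sum_range_succ]

theorem sum_large_sq_le {α : ℕ → ℝ} {B w : ℝ} (hB : HasSum (fun k => α k ^ 4) B) (hw : 0 < w)
    (s : Finset ℕ) : ∑ k ∈ s with w < α k ^ 2, α k ^ 2 ≤ w⁻¹ * B := by
  calc _ ≤ ∑ k ∈ s with w < α k ^ 2, w⁻¹ * α k ^ 4 := by
        refine Finset.sum_le_sum fun k hk => ?_
        have h := (Finset.mem_filter.1 hk).2.le
        rw [inv_mul_eq_div, le_div_iff₀ hw]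
        nlinarith [sq_nonneg (α k)]
    _ = w⁻¹ * ∑ k ∈ s with w < α k ^ 2, α k ^ 4 := (Finset.mul_sum _ _ _).symm
    _ ≤ _ := by
        gcongr
        exact sum_le_hasSum _ (fun k _ => by positivity) hB

/-- The main term of the square is 2ηLℓ. The passage from 2η to 2η + κ absorbs the lower-order
terms, and the passage to 2η + 2κ absorbs the possible deficit of V relative to L. -/
theorem sq_div_le_of_large {η κ ℓ L V : ℝ} (hη0 : 0 < η) (hη1 : η < 1) (hκ : 0 < κ) (hκ1 : κ ≤ 1)
    (hL : 0 < L) (hℓ0 : 0 ≤ ℓ) (hℓ : 54 / κ ≤ √ℓ)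
    (hV1 : (2 * η + κ) / (2 * η + 2 * κ) * L ≤ V) (hV2 : V ≤ 4 * L) :
    (√(2 * η * L * ℓ) + √(2 * L) + 2 * √L + √V) ^ 2 / (2 * V) ≤ (η + κ) * ℓ := by
  have hLs : √L ^ 2 = L := Real.sq_sqrt hL.le
  have hL0 : 0 < √L := Real.sqrt_pos.2 hL
  have hr : √ℓ ^ 2 = ℓ := Real.sq_sqrt hℓ0
  have h54 : 54 ≤ κ * √ℓ := by rwa [div_le_iff₀' hκ] at hℓ
  have hr1 : 54 ≤ √ℓ := h54.trans (mul_le_of_le_one_left (Real.sqrt_nonneg _) hκ1)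
  set p := √(2 * η * ℓ) with hp
  have hp0 : 0 ≤ p := Real.sqrt_nonneg _
  have hpp : p ^ 2 = 2 * η * ℓ := Real.sq_sqrt (by positivity)
  have e1 : √(2 * η * L * ℓ) = p * √L := by
    rw [hp, ← Real.sqrt_mul (by positivity)]; ring_nf
  have e2 : √(2 * L) ≤ 2 * √L := by
    rw [Real.sqrt_le_left (by positivity), mul_pow, hLs]; linarith
  have e3 : √V ≤ 2 * √L := by
    rw [Real.sqrt_le_left (by positivity), mul_pow, hLs]; linarith
  have hple : p ≤ 3 / 2 * √ℓ := by
    rw [hp, Real.sqrt_le_left (by positivity), mul_pow, hr]; nlinarith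
  have hV0 : 0 < V := lt_of_lt_of_le (by positivity) hV1
  have hnum : (√(2 * η * L * ℓ) + √(2 * L) + 2 * √L + √V) ^ 2 ≤ L * ((2 * η + κ) * ℓ) := by
    calc _ ≤ ((p + 6) * √L) ^ 2 := by
          rw [e1]
          gcongr
          linarith
      -- Since p ≤ (3/2)√ℓ and √ℓ ≥ 1, the remainder 12p + 36 is at most 54√ℓ, hence at most κℓ.
      _ = L * (p ^ 2 + (12 * p + 36)) := by rw [mul_pow, hLs]; ring
      _ ≤ L * (p ^ 2 + κ * √ℓ ^ 2) := by
          gcongr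
          nlinarith
      _ = _ := by rw [hpp, hr]; ring
  rw [div_le_iff₀ (by positivity)]
  refine hnum.trans ?_
  rw [div_mul_eq_mul_div, div_le_iff₀ (by positivity)] at hV1
  nlinarith

/-- The bound for the supremum over `[0, 1]` at a fixed `x`, under explicit largeness conditions. -/
theorem real_supX_le_exp {Ω : Type*} [MeasurableSpace Ω] {P : Measure Ω} [IsProbabilityMeasure P]
    {g g' : ℕ → Ω → ℝ} (hg : GaussTrig.IsStdNormalPair P g g') {a : ℕ → ℝ} {j : ℕ → ℤ}
    (hj : StrictMonoOn j (Set.Ici 1)) {B : ℝ} (hB : HasSum (fun k : ℕ => a (k + 1) ^ 4) B)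
    {η L x : ℝ} (hη0 : 0 < η) (hη1 : η < 1) (hL : 1 < L)
    (hℓ : 54 / ((1 - η) / 8) ≤ √(Real.log L))
    (hA1 : (2 * η + (1 - η) / 8) / (2 * η + 2 * ((1 - η) / 8)) * L + B * L ^ ((1 + η) / 2)
      ≤ GaussTrig.A a x)
    (hA2 : GaussTrig.A a x ≤ 4 * L)
    (h1 : L ^ (1 - η) + 1 ≤ L / (4 * (B + 1)) - 2 * (B * L ^ ((1 + η) / 2)) / (B + 1))
    (h2 : L ^ (1 - η) + 1 ≤ L ^ (5 / 4 * (1 - η)) / 180) :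
    P.real {ω | GaussTrig.supX a j g g' x ω ≤ √(2 * η * L * Real.log L)} ≤
      Real.exp (-(L ^ (1 - η))) := by
  set ℓ := Real.log L with hℓdef
  set τ := (1 + η) / 2 with hτ
  set κ := (1 - η) / 8 with hκdef
  have hκ : 0 < κ := by rw [hκdef]; linarith
  have hL0 : 0 < L := by linarith
  have hℓ0 : 0 ≤ ℓ := Real.log_nonneg hL.le
  -- The shift by one turns the indices 1, …, ⌊x⌋ into a `Finset.range`.
  let α : ℕ → ℝ := fun k => a (k + 1)
  let l : ℕ → ℤ := fun k => j (k + 1)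
  have hl : Function.Injective l := by
    intro k k' h
    have := hj.injOn (show k + 1 ∈ Set.Ici 1 by simp) (show k' + 1 ∈ Set.Ici 1 by simp) h
    omega
  have hB0 : 0 ≤ B := hB.nonneg fun k => by positivity
  let w := L ^ (-τ)
  have hw : 0 < w := Real.rpow_pos_of_pos hL0 _
  have hwi : w⁻¹ = L ^ τ := by simp only [w, Real.rpow_neg hL0.le, inv_inv]
  set s := Finset.range ⌊x⌋₊ with hs
  let K := s.filter fun k => w < α k ^ 2
  let J := s.filter fun k => ¬ w < α k ^ 2
  have hJK : Disjoint J K := (Finset.disjoint_filter_filter_not s s _).symm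
  have hun : J ∪ K = s := by rw [Finset.union_comm]; exact Finset.filter_union_filter_not_eq _ s
  obtain ⟨n, hn, hdvd⟩ := exists_forall_not_dvd_sub hl s
  have hsumK : ∑ k ∈ K, α k ^ 2 ≤ B * L ^ τ := by
    rw [mul_comm, ← hwi]; exact sum_large_sq_le hB hw s
  have hsum : ∑ k ∈ J, α k ^ 2 + ∑ k ∈ K, α k ^ 2 = GaussTrig.A a x := by
    rw [← Finset.sum_union hJK, hun, GaussTrig.A, sum_Icc_one_eq_sum_range]
  set V := ∑ k ∈ J, α k ^ 2 with hVdef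
  have hV1 : (2 * η + κ) / (2 * η + 2 * κ) * L ≤ V := by linarith
  have hV2 : V ≤ 4 * L := by
    have : 0 ≤ ∑ k ∈ K, α k ^ 2 := Finset.sum_nonneg fun _ _ => sq_nonneg _
    linarith
  have hV0 : 0 < V := lt_of_lt_of_le (by positivity) hV1
  have main := real_forall_trig_le hg hn hJK
    (fun k hk k' hk' => hdvd k (Finset.mem_filter.1 hk).1 k' (Finset.mem_filter.1 hk').1)
    (fun k hk k' hk' => hdvd k (Finset.mem_filter.1 hk).1 k' (Finset.mem_filter.1 hk').1)
    α (M := √(2 * η * L * ℓ)) (u := L) (σ := √L) (β := B + 1) (m := B * L ^ τ) hw (by positivity)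
    (Real.sqrt_nonneg _) hL0 (Real.sqrt_pos.2 hL0)
    (fun k hk => not_lt.1 (Finset.mem_filter.1 hk).2)
    -- B + 1 is an admissible β because α² ≤ α⁴ + 1 ≤ B + 1; it is also positive when B = 0.
    (fun k _ => by
      have h4 : α k ^ 4 ≤ B := le_hasSum hB k fun _ _ => by positivity
      nlinarith [sq_nonneg (α k ^ 2 - 1), sq_nonneg (α k)])
    hsumK hV0
  rw [← hVdef, hun] at main
  have hsub : {ω | GaussTrig.supX a j g g' x ω ≤ √(2 * η * L * ℓ)} ⊆
      {ω | ∀ i : Fin n, ∑ k ∈ s, α k *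
        (g (k + 1) ω * Real.cos (2 * Real.pi * l k * (i / n)) +
          g' (k + 1) ω * Real.sin (2 * Real.pi * l k * (i / n))) ≤ √(2 * η * L * ℓ)} := by
    intro ω hω i
    have hn' : (0 : ℝ) < n := by exact_mod_cast hn
    have hi : ((i : ℕ) / n : ℝ) ∈ Set.Icc (0 : ℝ) 1 :=
      ⟨by positivity, (div_le_one hn').2 (by exact_mod_cast i.2.le)⟩
    have := le_ciSup (GaussTrig.bddAbove_X a j g g' x ω) ⟨(i : ℕ) / n, hi⟩
    refine le_trans (le_of_eq ?_) (this.trans hω)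
    simp only [GaussTrig.X]
    rw [sum_Icc_one_eq_sum_range]
  have hE := sq_div_le_of_large hη0 hη1 hκ (by rw [hκdef]; linarith) hL0 hℓ0 hℓ hV1 hV2
  have t1 : Real.exp (-(L / (4 * (B + 1))) + 2 * (B * L ^ τ) / (B + 1)) ≤
      Real.exp (-(L ^ (1 - η)) - 1) := by
    rw [Real.exp_le_exp]; linarith
  have t2 : Real.exp (-((√L * Real.exp (-((√(2 * η * L * ℓ) + √(2 * L) + 2 * √L + √V) ^ 2 /
      (2 * V)))) ^ 2 / (180 * w))) ≤ Real.exp (-(L ^ (1 - η)) - 1) := by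
    rw [Real.exp_le_exp]
    have h3 : L ^ (-(η + κ)) ≤
        Real.exp (-((√(2 * η * L * ℓ) + √(2 * L) + 2 * √L + √V) ^ 2 / (2 * V))) := by
      rw [Real.rpow_def_of_pos hL0, Real.exp_le_exp]
      linarith
    -- The exponent is 1 - 2(η + κ) + τ, equal to 5(1 - η)/4 for these κ and τ.
    have h4 : L ^ (5 / 4 * (1 - η)) / 180 = (√L * L ^ (-(η + κ))) ^ 2 / (180 * w) := by
      rw [mul_pow, Real.sq_sqrt hL0.le, ← Real.rpow_natCast (L ^ (-(η + κ))), ← Real.rpow_mul hL0.le,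
        mul_comm 180 w, ← div_div]
      congr 1
      rw [div_eq_mul_inv (L * _) w, hwi]
      nth_rw 2 [← Real.rpow_one L]
      rw [← Real.rpow_add hL0, ← Real.rpow_add hL0]
      congr 1
      rw [hτ, hκdef]
      push_cast
      ring
    have h5 : (√L * L ^ (-(η + κ))) ^ 2 / (180 * w) ≤ (√L * Real.exp (-((√(2 * η * L * ℓ) +
        √(2 * L) + 2 * √L + √V) ^ 2 / (2 * V)))) ^ 2 / (180 * w) := by
      gcongr
    linarith
  calc _ ≤ _ := measureReal_mono hsub (measure_ne_top _ _)
    _ ≤ _ := main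
    -- The extra -1 in each exponent pays for adding two terms, since 2 ≤ e.
    _ ≤ Real.exp (-(L ^ (1 - η)) - 1) + Real.exp (-(L ^ (1 - η)) - 1) := add_le_add t1 t2
    _ = 2 * Real.exp (-1) * Real.exp (-(L ^ (1 - η))) := by
        rw [sub_eq_add_neg, Real.exp_add]; ring
    _ ≤ 1 * Real.exp (-(L ^ (1 - η))) := by
        gcongr
        rw [Real.exp_neg, mul_inv_le_iff₀ (Real.exp_pos _)]
        have := Real.add_one_le_exp 1
        linarith
    _ = _ := one_mul _

theorem eventually_rpow_add_const_le {p q c d : ℝ} (hq : 0 < q) (hpq : p < q) (hc : 0 < c) :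
    ∀ᶠ L : ℝ in atTop, L ^ p + d ≤ c * L ^ q := by
  have h1 := (tendsto_rpow_atTop (sub_pos.2 hpq)).eventually_ge_atTop (c / 2)⁻¹
  have h2 := (tendsto_rpow_atTop hq).eventually_ge_atTop (d / (c / 2))
  filter_upwards [h1, h2, eventually_gt_atTop 0] with L h1 h2 hL
  rw [Real.rpow_sub hL, le_div_iff₀ (Real.rpow_pos_of_pos hL p),
    inv_mul_le_iff₀ (half_pos hc)] at h1
  rw [div_le_iff₀ (half_pos hc)] at h2
  linarith

end Asymptotics

/-! ### The main theorem. -/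

theorem mainTheorem3 :
    ∃ C : ℝ, 0 < C ∧
      ∀ (η : ℝ), 0 < η → η < 1 →
      ∀ (a : ℕ → ℝ) (j : ℕ → ℤ), StrictMonoOn j (Set.Ici 1) →
      ∀ (Ω : Type*) [MeasurableSpace Ω] (P : Measure Ω) [IsProbabilityMeasure P]
        (g g' : ℕ → Ω → ℝ), GaussTrig.IsStdNormalPair P g g' →
      (GaussTrig.A a ~[atTop] fun x : ℝ => Real.log (Real.log x)) →
      ∀ B : ℝ, HasSum (fun k : ℕ => a (k + 1) ^ 4) B →
      ∀ᶠ x : ℝ in atTop,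
        P.real {ω | GaussTrig.supX a j g g' x ω ≤
            Real.sqrt (2 * η * Real.log (Real.log x) * Real.log (Real.log (Real.log x)))} ≤
          Real.exp (-(C * Real.log (Real.log x) ^ (1 - η) /
            Real.sqrt (8 * η * (B + 1) * Real.log (Real.log (Real.log x))))) := by
  refine ⟨1, one_pos, fun η hη0 hη1 a j hj Ω _ P _ g g' hg hA B hB => ?_⟩
  have hB0 : 0 ≤ B := hB.nonneg fun k => by positivity
  have hLL : Tendsto (fun x : ℝ => Real.log (Real.log x)) atTop atTop :=
    Real.tendsto_log_atTop.comp Real.tendsto_log_atTop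
  have hℓ : Tendsto (fun L : ℝ => Real.log L) atTop atTop := Real.tendsto_log_atTop
  set κ := (1 - η) / 8 with hκ
  have hκ0 : 0 < κ := by rw [hκ]; linarith
  set ρ := (2 * η + κ) / (2 * η + 2 * κ) with hρ
  have hρ1 : 0 < 1 - ρ := by
    rw [hρ, sub_pos, div_lt_one (by positivity)]; linarith
  -- The slack 1 - ρ is shared equally between the error in A(x) ~ L and the variance removed with
  -- the large coefficients.
  have hA' := hA.isLittleO.def (half_pos hρ1)
  have c0 : ∀ᶠ L : ℝ in atTop, 1 < L := eventually_gt_atTop 1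
  have c1 : ∀ᶠ L : ℝ in atTop, 54 / κ ≤ √(Real.log L) :=
    (Real.tendsto_sqrt_atTop.comp hℓ).eventually_ge_atTop _
  have c2 : ∀ᶠ L : ℝ in atTop, 1 / (8 * η * (B + 1)) ≤ Real.log L := hℓ.eventually_ge_atTop _
  have c3 : ∀ᶠ L : ℝ in atTop, L ^ ((1 + η) / 2) + 0 ≤ (1 - ρ) / 2 / (B + 1) * L ^ (1 : ℝ) :=
    eventually_rpow_add_const_le one_pos (by linarith) (by positivity)
  have c4 : ∀ᶠ L : ℝ in atTop, L ^ ((1 + η) / 2) + 0 ≤ 1 / (16 * (B + 1)) * L ^ (1 : ℝ) :=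
    eventually_rpow_add_const_le one_pos (by linarith) (by positivity)
  have c5 : ∀ᶠ L : ℝ in atTop, L ^ (1 - η) + 1 ≤ 1 / (8 * (B + 1)) * L ^ (1 : ℝ) :=
    eventually_rpow_add_const_le one_pos (by linarith) (by positivity)
  have c6 : ∀ᶠ L : ℝ in atTop, L ^ (1 - η) + 1 ≤ 1 / 180 * L ^ (5 / 4 * (1 - η)) :=
    eventually_rpow_add_const_le (by linarith) (by linarith) (by norm_num)
  filter_upwards [hA', hLL.eventually c0, hLL.eventually c1, hLL.eventually c2, hLL.eventually c3,
    hLL.eventually c4, hLL.eventually c5, hLL.eventually c6] with x hA h0 h1 h2 h3 h4 h5 h6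
  set L := Real.log (Real.log x)
  have hL0 : 0 < L := by linarith
  rw [Real.rpow_one] at h3 h4 h5
  rw [Pi.sub_apply, Real.norm_eq_abs, Real.norm_of_nonneg hL0.le, abs_le] at hA
  have hpos : 0 ≤ L ^ ((1 + η) / 2) := Real.rpow_nonneg hL0.le _
  have hBL : B * L ^ ((1 + η) / 2) ≤ (1 - ρ) / 2 * L := by
    rw [add_zero, div_mul_eq_mul_div, le_div_iff₀ (by positivity)] at h3
    linarith
  have hρ0 : 0 ≤ ρ := by positivity
  have key := real_supX_le_exp hg hj hB (x := x) hη0 hη1 h0 h1 (by linarith) (by nlinarith)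
    (by
      have e1 : 2 * (B * L ^ ((1 + η) / 2)) / (B + 1) ≤ 2 * L ^ ((1 + η) / 2) := by
        rw [div_le_iff₀ (by positivity)]
        nlinarith
      have e2 : L / (4 * (B + 1)) = 2 * (1 / (8 * (B + 1)) * L) := by field_simp; norm_num
      have e3 : 2 * (1 / (16 * (B + 1)) * L) = 1 / (8 * (B + 1)) * L := by field_simp; norm_num
      linarith)
    (by linarith)
  -- The square root in the denominator is at least 1 once log L ≥ 1/(8η(B + 1)), so C = 1 suffices.
  refine key.trans ?_
  rw [Real.exp_le_exp, neg_le_neg_iff, one_mul]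
  apply div_le_self (Real.rpow_nonneg hL0.le _)
  rw [Real.one_le_sqrt]
  rwa [div_le_iff₀' (by positivity)] at h2
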